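/- For a finite simple graph $G$, let $\Lambda(G)$ be the number of injections $f:\{0,1,2,3\}\to V(G)$ such that $f(0)f(2)$ is an edge of $G$ and $f(1)f(3)$ is a non-edge of $G$; that is, the number of embeddings into $G$ of the 4-vertex graph $H_0$ with one red edge $02$ and one blue edge $13$, where red edges must be mapped to edges and blue edges to non-edges. Let $\Lambda(n)$ be the maximum of $\Lambda(G)$ over all graphs $G$ with $n$ vertices, and call an $n$-vertex graph $G$ extremal if $\Lambda(G)=\Lambda(n)$. For integers $n$ and $1\le e\le\binom n2$, the quasi-clique $QC(n,e)$ is the graph with $n$ vertices and $e$ edges obtained from the complete graph $K_{k+1}$, where $k$ is the largest integer with $\binom k2<e$, by removing $\binom{k+1}2-e$ edges that form a star and then adding $n-k-1$ isolated vertices. **Theorem.** Let $n\ge 4$ be an integer and let $$k_0:=\left\lfloor\frac{3+\sqrt{2n^2-10n+13}}{2}\right\rfloor .$$ Then $\binom{k_0+1}2\le\binom n2$ and $\Lambda(n)=\Lambda\left(QC\left(n,\binom{k_0+1}2\right)\right)$. Moreover: 1. If $2n^2-10n+13$ is not the square of an integer, then an $n$-vertex graph is extremal if and only if it is isomorphic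 to $QC\left(n,\binom{k_0+1}2\right)$ or to its complement. 2. If $2n^2-10n+13$ is the square of an integer, then there are at least $2(k_0+1)$ pairwise non-isomorphic extremal graphs with $n$ vertices. -/

import Mathlib

/-- A blue-red edge-coloured graph: the red edges and the blue edges are disjoint sets of edges
on the same vertex set (pairs may be uncoloured). -/
structure ColouredGraph (V : Type*) where
  red : SimpleGraph V
  blue : SimpleGraph V
  disjoint : Disjoint red blue

/-- `embCount H G` is `Λ_H(G)`: the number of injections `V(H) → V(G)` that map red edges of `H`
to edges of `G` and blue edges of `H` to non-edges of `G`. -/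
noncomputable def embCount {V W : Type*} (H : ColouredGraph V) (G : SimpleGraph W) : ℕ :=
  Nat.card {f : V ↪ W //
    (∀ u v, H.red.Adj u v → G.Adj (f u) (f v)) ∧
    (∀ u v, H.blue.Adj u v → ¬ G.Adj (f u) (f v))}

/-- `maxEmbCount H n` is `Λ_H(n)`: the maximum of `Λ_H(G)` over the (finitely many) graphs `G`
with vertex set `Fin n`. -/
noncomputable def maxEmbCount {V : Type*} (H : ColouredGraph V) (n : ℕ) : ℕ :=
  (Finset.univ : Finset (SimpleGraph (Fin n))).sup fun G => embCount H G

/-- A graph `G` of order `n` is extremal for `H` if it attains the maximum `Λ_H(n)`. -/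
def IsExtremal {V : Type*} {n : ℕ} (H : ColouredGraph V) (G : SimpleGraph (Fin n)) : Prop :=
  embCount H G = maxEmbCount H n

/-- The coloured graph `H_0` on `{0, 1, 2, 3}`: one red edge `02` and one blue edge `13`. -/
def graphH0 : ColouredGraph (Fin 4) where
  red := SimpleGraph.fromEdgeSet {s(0, 2)}
  blue := SimpleGraph.fromEdgeSet {s(1, 3)}
  disjoint := by
    rw [SimpleGraph.disjoint_fromEdgeSet, SimpleGraph.edgeSet_fromEdgeSet]
    refine Set.disjoint_left.2 fun x hx hy => ?_
    have h1 : x = s(0, 2) := hx.1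
    have h2 : x = s(1, 3) := hy
    rw [h1] at h2
    exact absurd h2 (by decide)

/-- The largest `k` with `k.choose 2 < e` (for `e ≥ 1`; it is `0` for `e = 0`). -/
def cliqueIndex (e : ℕ) : ℕ := Nat.findGreatest (fun k => k.choose 2 < e) e

theorem cliqueIndex_isGreatest {e : ℕ} (he : 1 ≤ e) :
    IsGreatest {k : ℕ | k.choose 2 < e} (cliqueIndex e) := by
  refine ⟨?_, fun m hm => ?_⟩
  · exact Nat.findGreatest_spec (P := fun k => k.choose 2 < e) (m := 0) (Nat.zero_le e)
      (show Nat.choose 0 2 < e from he)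
  · have hm' : m.choose 2 < e := hm
    refine Nat.le_findGreatest (P := fun k => k.choose 2 < e) ?_ hm'
    by_contra hlt
    have h1 : (e + 1).choose 2 ≤ m.choose 2 := Nat.choose_le_choose 2 (by omega)
    have h2 : (e + 1).choose 2 = e + e.choose 2 := by
      rw [Nat.choose_succ_succ' e 1, Nat.choose_one_right]
    omega

/-- The quasi-clique `QC(n, e)`, for `e ≤ n.choose 2`, with vertex set `Fin n`. With
`k = cliqueIndex e`, take the complete graph on the `k + 1` vertices `0, …, k`, remove the star with
centre `k` and the `(k + 1).choose 2 - e` leaves `0, 1, …`, and leave the remaining `n - k - 1`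
vertices isolated. -/
def quasiClique (n e : ℕ) : SimpleGraph (Fin n) :=
  SimpleGraph.fromRel fun i j =>
    (i : ℕ) < j ∧ (j : ℕ) ≤ cliqueIndex e ∧
      ¬ ((j : ℕ) = cliqueIndex e ∧ (i : ℕ) < (cliqueIndex e + 1).choose 2 - e)

/-! Counting disjoint pairs (edge, non-edge) turns Λ(G) into 4 ∑ d² - (∑ d)² + μ ∑ d with μ =
(n-1)(n-4) (`embCount_graphH0`), so the task is to maximise this functional of the degrees. It is
studied for every μ: complementation preserves its shape and only replaces μ by a dual value, while
deleting an isolated vertex keeps μ but changes n and hence the dual.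

The core is `IsOptimal.structured`. Single-edge changes show that an optimal graph has an isolated
or a dominating vertex; up to complement, delete an isolated one and induct. The only new shape that
could arise is a split graph (a clique K_a joined to b independent vertices) plus an isolated
vertex. It is beaten by larger or smaller split graphs if b ≥ a, and by cliques through the
quasi-clique with equally many edges if b < a, unless two consecutive cliques or split graphs tie at
the maximum.

For the actual μ, which is self-dual, split graphs have the values of cliques, and the value of K_m
is unimodal in m with a maximum at k₀ + 1 (`completeValue_add_one`). Ties force 2n² - 10n + 13 to be
a square. Conversely, in the square case K_{k₀} and K_{k₀+1} tie, and by the affine interpolation of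
`degFunctional_cliqueWithVertex` all quasi-cliques between them are extremal. -/

/-! ### The degree functional under complements, embeddings and edge insertion -/

section DegreeFunctional

open Classical in
/-- The integer-valued adjacency indicator of a graph. -/
noncomputable def adjZ {V : Type*} (G : SimpleGraph V) (x y : V) : ℤ := if G.Adj x y then 1 else 0

/-- The degree of a vertex, as an integer. -/
noncomputable def degZ {V : Type*} [Fintype V] (G : SimpleGraph V) (x : V) : ℤ := ∑ y, adjZ G x y

/-- The sum of all degrees. -/
noncomputable def degSum {V : Type*} [Fintype V] (G : SimpleGraph V) : ℤ := ∑ x, degZ G x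

/-- The sum of the squares of all degrees. -/
noncomputable def degSqSum {V : Type*} [Fintype V] (G : SimpleGraph V) : ℤ := ∑ x, degZ G x ^ 2

/-- The functional `4 ∑ d(x)² - (∑ d(x))² + μ ∑ d(x)` of the degrees `d(x)` of a graph. -/
noncomputable def degFunctional {V : Type*} [Fintype V] (μ : ℤ) (G : SimpleGraph V) : ℤ :=
  4 * degSqSum G - degSum G ^ 2 + μ * degSum G

variable {V W : Type*}

theorem adjZ_congr {G : SimpleGraph V} {H : SimpleGraph W} {x y : V} {u v : W}
    (h : G.Adj x y ↔ H.Adj u v) : adjZ G x y = adjZ H u v := by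
  unfold adjZ
  by_cases hG : G.Adj x y
  · rw [if_pos hG, if_pos (h.1 hG)]
  · rw [if_neg hG, if_neg (mt h.2 hG)]

theorem adjZ_comm (G : SimpleGraph V) (x y : V) : adjZ G x y = adjZ G y x :=
  adjZ_congr (G.adj_comm x y)

theorem adjZ_of_adj {G : SimpleGraph V} {x y : V} (h : G.Adj x y) : adjZ G x y = 1 := if_pos h

theorem adjZ_of_not_adj {G : SimpleGraph V} {x y : V} (h : ¬ G.Adj x y) : adjZ G x y = 0 := if_neg h

theorem adjZ_compl [DecidableEq V] (G : SimpleGraph V) (x y : V) :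
    adjZ Gᶜ x y = 1 - (if x = y then 1 else 0) - adjZ G x y := by
  unfold adjZ
  by_cases h : x = y
  · subst h; simp
  · by_cases h' : G.Adj x y <;> simp [h, h']

theorem map_iso_eq {G : SimpleGraph V} {H : SimpleGraph W} (e : G ≃g H) :
    G.map e.toEquiv.toEmbedding = H := by
  ext x y
  rw [SimpleGraph.map_adj]
  constructor
  · rintro ⟨a, b, h, rfl, rfl⟩
    exact e.map_adj_iff.2 h
  · intro h
    exact ⟨e.symm x, e.symm y, e.symm.map_adj_iff.2 h, by simp, by simp⟩

variable [Fintype V]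

theorem degZ_map_of_notMem (H : SimpleGraph W) (f : W ↪ V) {x : V} (hx : x ∉ Set.range f) :
    degZ (H.map f) x = 0 := by
  refine Finset.sum_eq_zero fun y _ => adjZ_of_not_adj fun h => hx ?_
  obtain ⟨a, b, -, rfl, -⟩ := (SimpleGraph.map_adj f H _ _).1 h
  exact ⟨a, rfl⟩

variable [Fintype W]

theorem degZ_compl (G : SimpleGraph V) (x : V) :
    degZ Gᶜ x = Fintype.card V - 1 - degZ G x := by
  classical
  simp [degZ, adjZ_compl, Finset.sum_sub_distrib]

theorem degSum_compl (G : SimpleGraph V) :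
    degSum Gᶜ = Fintype.card V * (Fintype.card V - 1) - degSum G := by
  simp only [degSum, degZ_compl, Finset.sum_sub_distrib]
  simp; ring

theorem degSqSum_compl (G : SimpleGraph V) :
    degSqSum Gᶜ = Fintype.card V * ((Fintype.card V : ℤ) - 1) ^ 2
      - 2 * (Fintype.card V - 1) * degSum G + degSqSum G := by
  have h : ∀ x, degZ Gᶜ x ^ 2 = ((Fintype.card V : ℤ) - 1) ^ 2
      - 2 * (Fintype.card V - 1) * degZ G x + degZ G x ^ 2 := fun x => by
    rw [degZ_compl]; ring
  simp only [degSqSum, h, degSum, Finset.sum_add_distrib, Finset.sum_sub_distrib, Finset.mul_sum]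
  simp

/-- The value at the complete graph on `n` vertices. -/
def completeValue (μ n : ℤ) : ℤ := 4 * (n * (n - 1) ^ 2) - (n * (n - 1)) ^ 2 + μ * (n * (n - 1))

/-- The parameter dual to `μ` under complementation. -/
def dualParam (μ n : ℤ) : ℤ := 2 * ((n - 1) * (n - 4)) - μ

theorem dualParam_dualParam (μ n : ℤ) : dualParam (dualParam μ n) n = μ := by
  unfold dualParam; ring

/-- Replacing d by n - 1 - d keeps the coefficients of ∑ d² and (∑ d)², so only the linear
coefficient and the constant change. -/
theorem degFunctional_compl (μ : ℤ) (G : SimpleGraph V) :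
    degFunctional μ Gᶜ = completeValue μ (Fintype.card V)
      + degFunctional (dualParam μ (Fintype.card V)) G := by
  simp only [degFunctional, degSum_compl, degSqSum_compl, completeValue, dualParam]
  ring

theorem degZ_map_apply (H : SimpleGraph W) (f : W ↪ V) (x : W) :
    degZ (H.map f) (f x) = degZ H x := by
  refine (Fintype.sum_of_injective f f.injective _ _ ?_ ?_).symm
  · intro y hy
    refine adjZ_of_not_adj fun h => hy ?_
    obtain ⟨a, b, -, -, rfl⟩ := (SimpleGraph.map_adj f H _ _).1 h
    exact ⟨b, rfl⟩
  · intro y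
    exact adjZ_congr SimpleGraph.map_adj_apply.symm

theorem degSum_map (H : SimpleGraph W) (f : W ↪ V) : degSum (H.map f) = degSum H :=
  (Fintype.sum_of_injective f f.injective _ _ (fun _ hx => degZ_map_of_notMem H f hx)
    fun x => (degZ_map_apply H f x).symm).symm

theorem degSqSum_map (H : SimpleGraph W) (f : W ↪ V) : degSqSum (H.map f) = degSqSum H :=
  (Fintype.sum_of_injective f f.injective _ _
    (fun _ hx => by rw [degZ_map_of_notMem H f hx]; norm_num)
    fun x => by rw [degZ_map_apply H f x]).symm

theorem degFunctional_map (μ : ℤ) (H : SimpleGraph W) (f : W ↪ V) :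
    degFunctional μ (H.map f) = degFunctional μ H := by
  simp only [degFunctional, degSum_map, degSqSum_map]

theorem degSum_iso {G : SimpleGraph V} {H : SimpleGraph W} (e : G ≃g H) : degSum G = degSum H := by
  rw [← map_iso_eq e, degSum_map]

theorem degFunctional_iso (μ : ℤ) {G : SimpleGraph V} {H : SimpleGraph W} (e : G ≃g H) :
    degFunctional μ G = degFunctional μ H := by
  rw [← map_iso_eq e, degFunctional_map]

theorem degFunctional_sup_edge (μ : ℤ) (G : SimpleGraph V) {v w : V} (hvw : v ≠ w)
    (h : ¬ G.Adj v w) :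
    degFunctional μ (G ⊔ SimpleGraph.edge v w) = degFunctional μ G
      + 4 * (2 * degZ G v + 2 * degZ G w + 2) - 4 * degSum G - 4 + 2 * μ := by
  classical
  have hadj : ∀ x y, adjZ (G ⊔ SimpleGraph.edge v w) x y = adjZ G x y
      + (if x = v then if y = w then 1 else 0 else 0)
      + (if x = w then if y = v then 1 else 0 else 0) := by
    intro x y
    unfold adjZ
    rw [SimpleGraph.sup_adj, SimpleGraph.edge_adj]
    have h' : ¬ G.Adj w v := fun h' => h h'.symm
    by_cases h1 : x = v <;> by_cases h2 : y = w <;> by_cases h3 : x = w <;> by_cases h4 : y = v <;>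
      simp_all
  have hdeg : ∀ x, degZ (G ⊔ SimpleGraph.edge v w) x = degZ G x
      + (if x = v then 1 else 0) + (if x = w then 1 else 0) := by
    intro x
    simp only [degZ, hadj, Finset.sum_add_distrib]
    congr 2
    · split_ifs <;> simp
    · split_ifs <;> simp
  have hsum : degSum (G ⊔ SimpleGraph.edge v w) = degSum G + 2 := by
    simp only [degSum, hdeg, Finset.sum_add_distrib]
    simp; ring
  have hsq : ∀ x, degZ (G ⊔ SimpleGraph.edge v w) x ^ 2 = degZ G x ^ 2
      + (if x = v then 2 * degZ G x + 1 else 0) + (if x = w then 2 * degZ G x + 1 else 0) := by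
    intro x
    rw [hdeg]
    by_cases h1 : x = v
    · have : x ≠ w := fun h2 => hvw (h1.symm.trans h2)
      simp [h1, hvw]; ring
    · by_cases h2 : x = w <;> simp [h1, h2, hvw.symm]; ring
  have hsqsum : degSqSum (G ⊔ SimpleGraph.edge v w)
      = degSqSum G + (2 * degZ G v + 1) + (2 * degZ G w + 1) := by
    simp only [degSqSum, hsq, Finset.sum_add_distrib]
    simp
  simp only [degFunctional, hsum, hsqsum]
  ring

end DegreeFunctional

/-! ### Values of cliques, quasi-cliques and split graphs -/

section Cliques

variable {V W : Type*}

/-- The complete graph on `A` together with isolated vertices outside `A`. -/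
def cliqueOn (A : Finset V) : SimpleGraph V where
  Adj x y := x ≠ y ∧ x ∈ A ∧ y ∈ A
  symm := ⟨fun _ _ h => ⟨h.1.symm, h.2.2, h.2.1⟩⟩
  loopless := ⟨fun _ h => h.1 rfl⟩

theorem cliqueOn_adj (A : Finset V) (x y : V) :
    (cliqueOn A).Adj x y ↔ x ≠ y ∧ x ∈ A ∧ y ∈ A := Iff.rfl

/-- The complete graph on `A` together with a further vertex `w` joined to `B ⊆ A`. -/
def cliqueWithVertex (A B : Finset V) (w : V) : SimpleGraph V where
  Adj x y := x ≠ y ∧ (x ∈ A ∧ y ∈ A ∨ x = w ∧ y ∈ B ∨ y = w ∧ x ∈ B)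
  symm := ⟨fun _ _ h => ⟨h.1.symm, by tauto⟩⟩
  loopless := ⟨fun _ h => h.1 rfl⟩

/-- The value of the degree functional at the complement of `cliqueOn B` on `a + b` vertices,
where `B` has `b` elements. -/
def splitValue (μ a b : ℤ) : ℤ :=
  4 * (a * (a + b - 1) ^ 2 + b * a ^ 2) - (a * (a - 1) + 2 * a * b) ^ 2
    + μ * (a * (a - 1) + 2 * a * b)

theorem adjZ_cliqueWithVertex [DecidableEq V] {A B : Finset V} {w : V} (hB : B ⊆ A) (hw : w ∉ A)
    (x y : V) :
    adjZ (cliqueWithVertex A B w) x y = (if x ∈ A then (if y ∈ A then 1 else 0)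
      - (if y = x then 1 else 0) else 0)
      + (if x = w then if y ∈ B then 1 else 0 else 0)
      + (if x ∈ B then if y = w then 1 else 0 else 0) := by
  have hwB : w ∉ B := fun h => hw (hB h)
  unfold adjZ
  simp only [cliqueWithVertex]
  by_cases hxy : y = x
  · subst hxy
    by_cases h1 : y = w
    · subst h1; simp [hw, hwB]
    · by_cases h2 : y ∈ A <;> simp [h1, h2]
  · by_cases h1 : x = w
    · subst h1
      simp [hw, hwB, hxy, Ne.symm hxy]
    · by_cases h2 : y = w
      · subst h2
        simp [hw, hwB, hxy, Ne.symm hxy]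
      · simp only [h1, h2, hxy]
        by_cases h3 : x ∈ A <;> by_cases h4 : y ∈ A <;> simp [h3, h4, Ne.symm hxy]

variable [Fintype V]

theorem degZ_cliqueWithVertex [DecidableEq V] {A B : Finset V} {w : V} (hB : B ⊆ A) (hw : w ∉ A)
    (x : V) :
    degZ (cliqueWithVertex A B w) x = (if x ∈ A then (A.card : ℤ) - 1 else 0)
      + (if x = w then (B.card : ℤ) else 0) + (if x ∈ B then 1 else 0) := by
  simp only [degZ, adjZ_cliqueWithVertex hB hw, Finset.sum_add_distrib]
  congr 2
  · split_ifs <;> simp [Finset.sum_sub_distrib]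
  · split_ifs <;> simp
  · split_ifs <;> simp

theorem degSum_cliqueWithVertex {A B : Finset V} {w : V} (hB : B ⊆ A) (hw : w ∉ A) :
    degSum (cliqueWithVertex A B w) = A.card * ((A.card : ℤ) - 1) + 2 * B.card := by
  classical
  simp only [degSum, degZ_cliqueWithVertex hB hw, Finset.sum_add_distrib]
  simp
  ring

theorem degSqSum_cliqueWithVertex {A B : Finset V} {w : V} (hB : B ⊆ A) (hw : w ∉ A) :
    degSqSum (cliqueWithVertex A B w) = A.card * ((A.card : ℤ) - 1) ^ 2
      + B.card * (2 * (A.card : ℤ) - 1) + (B.card : ℤ) ^ 2 := by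
  classical
  have hwB : w ∉ B := fun h => hw (hB h)
  have h : ∀ x, degZ (cliqueWithVertex A B w) x ^ 2 =
      (if x ∈ A then ((A.card : ℤ) - 1) ^ 2 else 0)
      + (if x = w then (B.card : ℤ) ^ 2 else 0) + (if x ∈ B then 2 * (A.card : ℤ) - 1 else 0) := by
    intro x
    rw [degZ_cliqueWithVertex hB hw]
    by_cases h1 : x = w
    · subst h1; simp [hw, hwB]
    · by_cases h2 : x ∈ B
      · simp [h1, h2, hB h2]; ring
      · simp [h1, h2]
  simp only [degSqSum, h, Finset.sum_add_distrib]
  simp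
  ring

/-- The terms 4|B|² from 4 ∑ d² and from (∑ d)² cancel, so the value is affine in |B| and
interpolates between two consecutive cliques. The factor |A| clears the denominator. -/
theorem degFunctional_cliqueWithVertex (μ : ℤ) {A B : Finset V} {w : V} (hB : B ⊆ A) (hw : w ∉ A) :
    A.card * degFunctional μ (cliqueWithVertex A B w) =
      ((A.card : ℤ) - B.card) * completeValue μ A.card
        + B.card * completeValue μ (A.card + 1) := by
  simp only [degFunctional, degSum_cliqueWithVertex hB hw, degSqSum_cliqueWithVertex hB hw,
    completeValue]
  ring

theorem degFunctional_cliqueOn (μ : ℤ) (A : Finset V) :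
    degFunctional μ (cliqueOn A) = completeValue μ A.card := by
  classical
  have hadj : ∀ x y, adjZ (cliqueOn A) x y =
      if x ∈ A then (if y ∈ A then 1 else 0) - (if y = x then 1 else 0) else 0 := by
    intro x y
    unfold adjZ
    rw [cliqueOn_adj]
    by_cases hxy : y = x
    · subst hxy
      by_cases h1 : y ∈ A <;> simp [h1]
    · by_cases h1 : x ∈ A <;> by_cases h2 : y ∈ A <;> simp [h1, h2, hxy, Ne.symm hxy]
  have hdeg : ∀ x, degZ (cliqueOn A) x = if x ∈ A then (A.card : ℤ) - 1 else 0 := by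
    intro x
    simp only [degZ, hadj]
    split_ifs <;> simp [Finset.sum_sub_distrib]
  simp only [degFunctional, degSum, degSqSum, hdeg, completeValue]
  simp
  ring

theorem splitValue_eq (μ a b : ℤ) :
    splitValue μ a b = completeValue μ (a + b) + completeValue (dualParam μ (a + b)) b := by
  unfold splitValue completeValue dualParam; ring

theorem degFunctional_of_compl_eq_cliqueOn (μ : ℤ) {G : SimpleGraph V} {B : Finset V}
    (h : Gᶜ = cliqueOn B) :
    degFunctional μ G = splitValue μ (Fintype.card V - B.card) B.card := by
  rw [← compl_compl G, degFunctional_compl, h, degFunctional_cliqueOn, splitValue_eq,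
    sub_add_cancel]

end Cliques

/-! ### Numerical comparison of a split graph plus an isolated vertex with its competitors -/

section Numeric

/-- If `b ≥ a`, the join of `K_a` with `b` independent vertices plus an isolated vertex is not better
than both of two genuine split graphs, and it ties only with both. -/
theorem tie_of_split_of_le {μ a b M : ℤ} (ha : 1 ≤ a) (hab : a ≤ b) (hM : splitValue μ a b = M)
    (h1 : splitValue μ a (b + 1) ≤ M) (h2 : splitValue μ (a - 1) (b + 2) ≤ M) :
    splitValue μ a (b + 1) = M ∧ splitValue μ (a - 1) (b + 2) = M := by
  -- The two competitors have a and a - 1 - b more edges, and both gain exactly g per extra edge.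
  -- Since a > 0 > a - 1 - b, neither can exceed M unless g = 0.
  obtain ⟨g, hg⟩ : ∃ g, g = 4 * (2 * a + 2 * b - 1) - 2 * (2 * (a * (a - 1) + 2 * a * b)) + 2 * μ :=
    ⟨_, rfl⟩
  have e1 : splitValue μ a (b + 1) = M + a * g := by
    rw [← hM, hg]; unfold splitValue; ring
  have e2 : splitValue μ (a - 1) (b + 2) = M + (a - 1 - b) * g := by
    rw [← hM, hg]; unfold splitValue; ring
  have : g = 0 := by
    rcases lt_trichotomy g 0 with h | h | h
    · nlinarith
    · exact h
    · nlinarith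
  rw [e1, e2, this]
  simp

theorem exists_choose_two_add (e : ℕ) : ∃ k t : ℕ, t ≤ k ∧ 2 * e = k * (k + 1) + 2 * t := by
  induction e with
  | zero => exact ⟨0, 0, le_rfl, rfl⟩
  | succ e ih =>
    obtain ⟨k, t, h, he⟩ := ih
    rcases h.lt_or_eq with h | h
    · exact ⟨k, t + 1, h, by rw [mul_add, he]; ring⟩
    · exact ⟨k + 1, 0, by omega, by rw [mul_add, he, h]; ring⟩

/-- If `b < a`, the join of `K_a` with `b` independent vertices plus an isolated vertex is not better
than both of two consecutive cliques, and it ties only with both. -/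
theorem tie_of_split_of_lt {μ M : ℤ} {a b : ℕ} (hb : 2 ≤ b) (hab : b < a)
    (hM : splitValue μ a b = M)
    (hc : ∀ m : ℕ, m ≤ a + b + 1 → completeValue μ m ≤ M) :
    ∃ m : ℕ, 1 ≤ m ∧ m < a + b + 1 ∧ completeValue μ m = M ∧ completeValue μ (m + 1) = M := by
  -- e is the number of edges of the split graph; below, e = C(k'+1, 2) + t describes the
  -- quasi-clique with the same number of edges.
  obtain ⟨e, he⟩ : ∃ e : ℕ, 2 * e + a = a * a + 2 * a * b := by
    obtain ⟨e, he⟩ : Even (a * (a - 1)) := Nat.even_mul_pred_self a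
    refine ⟨e + a * b, ?_⟩
    obtain ⟨a, rfl⟩ : ∃ c, a = c + 1 := ⟨a - 1, by omega⟩
    simp only [Nat.add_sub_cancel] at he
    nlinarith
  obtain ⟨k', t, ht, hk⟩ := exists_choose_two_add e
  obtain ⟨k, rfl⟩ : ∃ k, k = k' + 1 := ⟨_, rfl⟩
  have hk1 : k' + 1 < a + b := by
    by_contra hcon
    have : a + b ≤ k' + 1 := by omega
    nlinarith
  have hk2 : a ≤ k' + 1 := by
    by_contra hcon
    have : k' + 2 ≤ a := by omega
    nlinarith
  obtain ⟨r, hr⟩ : ∃ r : ℤ, r = a + b - (k' + 1) := ⟨_, rfl⟩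
  have hr1 : 1 ≤ r := by omega
  have hr2 : r ≤ a - 1 := by omega
  have heZ : (2 * e : ℤ) + a = a * a + 2 * a * b := by exact_mod_cast he
  have hkZ : (2 * e : ℤ) = k' * (k' + 1) + 2 * t := by exact_mod_cast hk
  have hkr : (k' : ℤ) = a + b - r - 1 := by rw [hr]; ring
  have ht2 : 2 * (t : ℤ) = a * a - a + 2 * a * b - (a + b - r - 1) * (a + b - r) := by
    rw [hkr] at hkZ; linarith
  -- The left side is k' + 1 times the value of that quasi-clique. With equal edge numbers only ∑ d²
  -- differs, and the quasi-clique gains a r (a - r) - t (2a - 1 - t).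
  have key : ((k' : ℤ) + 1 - t) * completeValue μ (k' + 1) + t * completeValue μ (k' + 2)
      = (k' + 1) * (M + 4 * (a * r * (a - r) - t * (2 * a - 1 - t))) := by
    have hS : (a : ℤ) * (a + b - 1) ^ 2 + b * a ^ 2 = t * (2 * k' + 1) + (k' + 1) * k' ^ 2 + t ^ 2
        - (a * r * (a - r) - t * (2 * a - 1 - t)) := by
      rw [hkr]
      linear_combination (1 - 2 * (a : ℤ) - (b - r)) * ht2
    have hE : (a : ℤ) * (a - 1) + 2 * a * b = k' * (k' + 1) + 2 * t := by linarith
    rw [← hM, splitValue, hS, hE]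
    unfold completeValue
    ring
  -- By concavity r (a - r) is least at the ends r = 1 and r = a - 1. The gain is then at least (a -
  -- t)(a - t - 1), a product of consecutive integers, hence nonnegative.
  have hQ : a * (a - 1) ≤ a * r * ((a : ℤ) - r) := by
    have : 0 ≤ (r - 1) * (a - 1 - r) := mul_nonneg (by omega) (by omega)
    have ha : (0 : ℤ) ≤ a := by omega
    nlinarith
  have hQ2 : 0 ≤ ((a : ℤ) - t) * (a - t - 1) := by
    rcases le_or_gt ((a : ℤ) - t) 0 with h | h
    · exact mul_nonneg_of_nonpos_of_nonpos h (by omega)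
    · exact mul_nonneg h.le (by omega)
  have h1 := hc (k' + 1) (by omega)
  have h2 := hc (k' + 2) (by omega)
  push_cast at h1 h2
  -- For t = 0 the gain is positive, so the single clique on k' + 1 vertices would exceed M.
  have htpos : 0 < t := by
    rcases Nat.eq_zero_or_pos t with h0 | h0
    · exfalso
      subst h0
      simp only [Nat.cast_zero, zero_mul, sub_zero, add_zero] at key
      have := mul_left_cancel₀ (by positivity) key
      nlinarith
    · exact h0
  have htk : (0 : ℤ) < k' + 1 - t := by omega
  have htZ : (0 : ℤ) < t := by omega
  -- A weighted mean with positive weights of two values at most M is at least M, so both values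
  -- equal M.
  have hle : ((k' : ℤ) + 1) * M ≤
      (k' + 1) * (M + 4 * (a * r * (a - r) - t * (2 * a - 1 - t))) :=
    mul_le_mul_of_nonneg_left (by nlinarith) (by positivity)
  have hA : 0 ≤ ((k' : ℤ) + 1 - t) * (M - completeValue μ (k' + 1)) :=
    mul_nonneg htk.le (by linarith)
  have hB : 0 ≤ (t : ℤ) * (M - completeValue μ (k' + 2)) := mul_nonneg htZ.le (by linarith)
  refine ⟨k' + 1, by omega, by omega, ?_, ?_⟩
  · have : ((k' : ℤ) + 1 - t) * (M - completeValue μ (k' + 1)) = 0 := by linarith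
    rcases mul_eq_zero.1 this with h | h
    · omega
    · push_cast; linarith
  · have : (t : ℤ) * (M - completeValue μ (k' + 2)) = 0 := by linarith
    rcases mul_eq_zero.1 this with h | h
    · omega
    · push_cast
      rw [add_assoc, one_add_one_eq_two]
      linarith

end Numeric

/-! ### Structure of the graphs maximising the functional -/

section Optimal

variable {V : Type}

/-- The graph `G` maximises the degree functional among all graphs on its vertex set. -/
def IsOptimal [Fintype V] (μ : ℤ) (G : SimpleGraph V) : Prop :=
  ∀ H : SimpleGraph V, degFunctional μ H ≤ degFunctional μ G

theorem IsOptimal.compl [Fintype V] {μ : ℤ} {G : SimpleGraph V} (h : IsOptimal μ G) :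
    IsOptimal (dualParam μ (Fintype.card V)) Gᶜ := by
  intro H
  have h1 := h Hᶜ
  have h2 := degFunctional_compl μ H
  have h3 := degFunctional_compl μ Gᶜ
  rw [compl_compl] at h3
  linarith

theorem IsOptimal.not_adj_le [Fintype V] {μ : ℤ} {G : SimpleGraph V} (h : IsOptimal μ G) {v w : V}
    (hvw : v ≠ w) (hadj : ¬ G.Adj v w) :
    8 * (degZ G v + degZ G w) ≤ 4 * degSum G - 4 - 2 * μ := by
  have h1 := h (G ⊔ SimpleGraph.edge v w)
  rw [degFunctional_sup_edge μ G hvw hadj] at h1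
  linarith

theorem IsOptimal.le_of_adj [Fintype V] {μ : ℤ} {G : SimpleGraph V} (h : IsOptimal μ G) {v w : V}
    (hadj : G.Adj v w) :
    4 * degSum G + 4 - 2 * μ ≤ 8 * (degZ G v + degZ G w) := by
  have h1 := h.compl.not_adj_le hadj.ne (fun h' => h'.2 hadj)
  rw [degZ_compl, degZ_compl, degSum_compl, dualParam] at h1
  linarith

/-- An optimal graph is a threshold graph, so it has an isolated or a dominating vertex. -/
theorem IsOptimal.exists_isolated_or_dominating [Fintype V] [Nonempty V] {μ : ℤ}
    {G : SimpleGraph V} (h : IsOptimal μ G) :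
    (∃ v, ∀ w, ¬ G.Adj v w) ∨ ∃ v, ∀ w, ¬ Gᶜ.Adj v w := by
  obtain ⟨v, -, hv⟩ := Finset.exists_min_image Finset.univ (degZ G) Finset.univ_nonempty
  obtain ⟨w, -, hw⟩ := Finset.exists_max_image Finset.univ (degZ G) Finset.univ_nonempty
  by_cases hiso : ∀ x, ¬ G.Adj v x
  · exact Or.inl ⟨v, hiso⟩
  · push Not at hiso
    obtain ⟨x, hx⟩ := hiso
    -- Adding wy and deleting vx are both no improvement, which gives d(w) + d(y) < d(v) + d(x).
    -- This contradicts the choice of v as minimum and w as maximum degree.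
    refine Or.inr ⟨w, fun y hy => ?_⟩
    have h1 := h.not_adj_le hy.1 hy.2
    have h2 := h.le_of_adj hx
    have h3 := hv y (Finset.mem_univ y)
    have h4 := hw x (Finset.mem_univ x)
    linarith

/-- Two consecutive cliques, or two consecutive split graphs, both attain the value `M`. -/
def IsTie (μ : ℤ) (n : ℕ) (M : ℤ) : Prop :=
  (∃ m : ℕ, 1 ≤ m ∧ m < n ∧ completeValue μ m = M ∧ completeValue μ (m + 1) = M) ∨
  ∃ m : ℕ, 1 ≤ m ∧ m < n ∧ splitValue μ (n - m) m = M ∧ splitValue μ (n - (m + 1)) (m + 1) = M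

theorem splitValue_eq_of_card (μ n b : ℤ) :
    splitValue μ (n - b) b = completeValue μ n + completeValue (dualParam μ n) b := by
  rw [splitValue_eq, sub_add_cancel]

/-- Split graphs are complements of cliques with isolated vertices, so complementation exchanges the
two alternatives. -/
theorem IsTie.compl [Fintype V] {μ : ℤ} {G : SimpleGraph V}
    (h : IsTie (dualParam μ (Fintype.card V)) (Fintype.card V)
      (degFunctional (dualParam μ (Fintype.card V)) Gᶜ)) :
    IsTie μ (Fintype.card V) (degFunctional μ G) := by
  have hG := degFunctional_compl μ Gᶜ
  rw [compl_compl] at hG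
  rcases h with ⟨m, h1, h2, h3, h4⟩ | ⟨m, h1, h2, h3, h4⟩
  · refine Or.inr ⟨m, h1, h2, ?_, ?_⟩
    · rw [splitValue_eq_of_card, h3, hG]
    · rw [splitValue_eq_of_card, h4, hG]
  · refine Or.inl ⟨m, h1, h2, ?_, ?_⟩
    · rw [splitValue_eq_of_card, dualParam_dualParam] at h3
      have h5 := degFunctional_compl (dualParam μ (Fintype.card V)) G
      rw [dualParam_dualParam] at h5
      linarith
    · rw [splitValue_eq_of_card, dualParam_dualParam] at h4
      have h5 := degFunctional_compl (dualParam μ (Fintype.card V)) G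
      rw [dualParam_dualParam] at h5
      linarith

theorem IsOptimal.completeValue_le [Fintype V] {μ : ℤ} {G : SimpleGraph V} (h : IsOptimal μ G)
    {m : ℕ} (hm : m ≤ Fintype.card V) : completeValue μ m ≤ degFunctional μ G := by
  obtain ⟨A, -, hA⟩ := Finset.exists_subset_card_eq (s := (Finset.univ : Finset V))
    (n := m) (by rwa [Finset.card_univ])
  have := h (cliqueOn A)
  rwa [degFunctional_cliqueOn, hA] at this

theorem IsOptimal.splitValue_le [Fintype V] {μ : ℤ} {G : SimpleGraph V} (h : IsOptimal μ G)
    {b : ℕ} (hb : b ≤ Fintype.card V) :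
    splitValue μ (Fintype.card V - b) b ≤ degFunctional μ G := by
  have h1 := h.compl.completeValue_le hb
  have hG := degFunctional_compl μ Gᶜ
  rw [compl_compl] at hG
  rw [splitValue_eq_of_card]
  linarith

/-- A split graph with an added isolated vertex can be optimal only if there is a tie. -/
theorem IsOptimal.isTie_of_split [Fintype V] {μ : ℤ} {G : SimpleGraph V} (h : IsOptimal μ G)
    {a b : ℕ} (ha : 1 ≤ a) (hb : 2 ≤ b) (hab : a + b + 1 = Fintype.card V)
    (hG : splitValue μ a b = degFunctional μ G) :
    IsTie μ (Fintype.card V) (degFunctional μ G) := by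
  have hZ : (Fintype.card V : ℤ) = a + b + 1 := by exact_mod_cast hab.symm
  rcases le_or_gt a b with hle | hlt
  · have h1 := h.splitValue_le (b := b + 1) (by omega)
    have h2 := h.splitValue_le (b := b + 2) (by omega)
    have e1 : (Fintype.card V : ℤ) - ((b + 1 : ℕ) : ℤ) = a := by push_cast; rw [hZ]; ring
    have e2 : (Fintype.card V : ℤ) - ((b + 2 : ℕ) : ℤ) = a - 1 := by push_cast; rw [hZ]; ring
    rw [e1] at h1
    rw [e2] at h2
    obtain ⟨h3, h4⟩ := tie_of_split_of_le (by omega) (by omega) hG (by exact_mod_cast h1)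
      (by exact_mod_cast h2)
    refine Or.inr ⟨b + 1, by omega, by omega, ?_, ?_⟩
    · rw [e1]; exact_mod_cast h3
    · have e3 : (Fintype.card V : ℤ) - (((b + 1 : ℕ) : ℤ) + 1) = a - 1 := by
        push_cast; rw [hZ]; ring
      rw [e3]; push_cast; rw [add_assoc, one_add_one_eq_two, h4]
  · obtain ⟨m, h1, h2, h3, h4⟩ := tie_of_split_of_lt hb hlt hG
      fun m hm => h.completeValue_le (by omega)
    exact Or.inl ⟨m, h1, by omega, h3, h4⟩

theorem cliqueOn_empty : cliqueOn (∅ : Finset V) = ⊥ := by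
  ext x y; simp [cliqueOn_adj]

theorem card_ne_vertex [Fintype V] (v : V) [Fintype {x // x ≠ v}] :
    Fintype.card {x // x ≠ v} + 1 = Fintype.card V := by
  classical
  have h : 0 < Fintype.card V := Fintype.card_pos_iff.2 ⟨v⟩
  rw [Fintype.card_subtype_compl, Fintype.card_subtype_eq]
  omega

/-- The structure of optimal graphs: cliques with isolated vertices and their complements, unless
there is a tie. -/
def Structured [Fintype V] (μ : ℤ) (G : SimpleGraph V) : Prop :=
  (∃ A, G = cliqueOn A) ∨ (∃ A, Gᶜ = cliqueOn A) ∨ IsTie μ (Fintype.card V) (degFunctional μ G)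

theorem Structured.of_compl [Fintype V] {μ : ℤ} {G : SimpleGraph V}
    (h : Structured (dualParam μ (Fintype.card V)) Gᶜ) : Structured μ G := by
  rcases h with h | h | h
  · exact Or.inr (Or.inl h)
  · rw [compl_compl] at h
    exact Or.inl h
  · exact Or.inr (Or.inr h.compl)

/-- Isolated vertices do not affect the functional, so the graph without v is again optimal for the
same μ. Cliques and clique ties carry over directly; a split graph or a split tie leads to
`IsOptimal.isTie_of_split`, apart from degenerate sizes. -/
theorem IsOptimal.structured_of_isolated [Fintype V] {μ : ℤ} {G : SimpleGraph V}
    (h : IsOptimal μ G) {v : V} (hv : ∀ w, ¬ G.Adj v w)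
    (ih : ∀ G' : SimpleGraph {x // x ≠ v}, ∀ _ : Fintype {x // x ≠ v}, IsOptimal μ G' →
      Structured μ G') : Structured μ G := by
  classical
  have hcard := card_ne_vertex v
  set f : {x // x ≠ v} ↪ V := Function.Embedding.subtype _ with hf
  obtain ⟨G', rfl⟩ : ∃ G' : SimpleGraph {x // x ≠ v}, G = G'.map f := by
    refine ⟨G.comap f, ?_⟩
    ext x y
    rw [SimpleGraph.map_adj]
    constructor
    · intro hxy
      have hx : x ≠ v := fun hx => hv y (hx ▸ hxy)
      have hy : y ≠ v := fun hy => hv x (hy ▸ hxy.symm)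
      exact ⟨⟨x, hx⟩, ⟨y, hy⟩, hxy, rfl, rfl⟩
    · rintro ⟨a, b, hab, rfl, rfl⟩
      exact hab
  have hopt : IsOptimal μ G' := by
    intro H
    have := h (H.map f)
    rwa [degFunctional_map, degFunctional_map] at this
  have hval := degFunctional_map μ G' f
  have hmap : ∀ A : Finset {x // x ≠ v}, (cliqueOn A).map f = cliqueOn (A.map f) := by
    intro A
    ext x y
    rw [SimpleGraph.map_adj, cliqueOn_adj]
    simp only [cliqueOn_adj, Finset.mem_map]
    constructor
    · rintro ⟨a, b, ⟨h1, h2, h3⟩, rfl, rfl⟩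
      exact ⟨fun h => h1 (f.injective h), ⟨a, h2, rfl⟩, b, h3, rfl⟩
    · rintro ⟨h1, ⟨a, h2, rfl⟩, b, h3, rfl⟩
      exact ⟨a, b, ⟨fun h => h1 (congrArg f h), h2, h3⟩, rfl, rfl⟩
  rcases ih G' inferInstance hopt with ⟨A, rfl⟩ | ⟨B, hB⟩ | ⟨m, h1, h2, h3, h4⟩ | ⟨m, h1, h2, h3, h4⟩
  · exact Or.inl ⟨_, hmap A⟩
  · have hle : B.card ≤ Fintype.card {x // x ≠ v} := B.card_le_univ
    have hsplit := degFunctional_of_compl_eq_cliqueOn μ hB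
    obtain ⟨a, ha⟩ : ∃ a, a + B.card = Fintype.card {x // x ≠ v} := ⟨_, Nat.sub_add_cancel hle⟩
    -- With at most one independent vertex the split graph is complete; with no dominating vertex (a
    -- = 0) it is empty. Both are cliques with isolated vertices.
    rcases Nat.lt_or_ge B.card 2 with hb | hb
    · left
      refine ⟨Finset.univ.map f, ?_⟩
      rw [← hmap]
      congr 1
      rw [← compl_compl G', hB]
      ext x y
      simp only [SimpleGraph.compl_adj, cliqueOn_adj, Finset.mem_univ, and_true]
      refine ⟨fun h => h.1, fun hxy => ⟨hxy, fun h => hxy ?_⟩⟩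
      exact Finset.card_le_one.1 (by omega) x h.2.1 y h.2.2
    · rcases Nat.eq_zero_or_pos a with h0 | h0
      · left
        refine ⟨∅, ?_⟩
        have hBu : B = Finset.univ := by rw [← Finset.card_eq_iff_eq_univ]; omega
        have : G' = cliqueOn ∅ := by
          rw [← compl_compl G', hB, hBu, cliqueOn_empty]
          ext x y
          simp [cliqueOn_adj]
        rw [this, hmap, Finset.map_empty]
      · right; right
        refine h.isTie_of_split h0 hb (by omega) ?_
        rw [hval, hsplit, ← ha]
        push_cast
        rw [add_sub_cancel_right]
  · rw [Structured, hval]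
    exact Or.inr (Or.inr (Or.inl ⟨m, h1, by omega, h3, h4⟩))
  · right; right
    obtain ⟨c, hc⟩ : ∃ c, c + 1 + m = Fintype.card {x // x ≠ v} := ⟨_, by
      rw [add_assoc, add_comm 1 m]; exact Nat.sub_add_cancel h2⟩
    rw [← hc] at h3 h4
    rw [← hval] at h3 h4
    -- Either of the two tied split graphs may be used, so for m = 1 the one with two independent
    -- vertices is taken. If it has no dominating vertex, then M = 0 and K_1 ties with K_2.
    rcases Nat.lt_or_ge m 2 with hm | hm
    · obtain rfl : m = 1 := by omega
      rcases Nat.eq_zero_or_pos c with h0 | h0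
      · subst h0
        rw [← h3]
        refine Or.inl ⟨1, le_rfl, by omega, ?_, ?_⟩
        · rw [h3, ← h4]; norm_num [completeValue, splitValue]
        · norm_num [completeValue, splitValue]
      · refine h.isTie_of_split (a := c) (b := 2) h0 le_rfl (by omega) ?_
        rw [← h4]; push_cast; congr 1; ring
    · refine h.isTie_of_split (a := c + 1) (b := m) (by omega) hm (by omega) ?_
      rw [← h3]; push_cast; congr 1; ring

/-- Quantifying over all μ inside the induction is essential: the dominating case passes to the
complement, and so to the dual parameter, before deleting a vertex. -/
theorem IsOptimal.structured : ∀ (n : ℕ) (V : Type) (_ : Fintype V), Fintype.card V = n →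
    ∀ (μ : ℤ) (G : SimpleGraph V), IsOptimal μ G → Structured μ G := by
  classical
  intro n
  induction n with
  | zero =>
    intro V _ hV μ G _
    have : IsEmpty V := Fintype.card_eq_zero_iff.1 hV
    exact Or.inl ⟨∅, by ext x; exact isEmptyElim x⟩
  | succ n ih =>
    intro V _ hV μ G h
    have : Nonempty V := Fintype.card_pos_iff.1 (by omega)
    have hcard : ∀ v : V, ∀ _ : Fintype {x // x ≠ v}, Fintype.card {x // x ≠ v} = n := by
      intro v _
      have := card_ne_vertex v
      omega
    rcases h.exists_isolated_or_dominating with ⟨v, hv⟩ | ⟨v, hv⟩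
    · exact h.structured_of_isolated hv fun G' i hG' => ih _ i (hcard v i) _ _ hG'
    · exact Structured.of_compl
        (h.compl.structured_of_isolated hv fun G' i hG' => ih _ i (hcard v i) _ _ hG')

end Optimal

/-! ### Embeddings of the coloured graph expressed through degrees -/

section Embeddings

variable {W : Type} [Fintype W]

theorem sum_adjZ_right (G : SimpleGraph W) (y : W) : ∑ x, adjZ G x y = degZ G y := by
  simp only [degZ, adjZ_comm G _ y]

/-- The number of ordered pairs `(x, y)` of distinct non-adjacent vertices that avoid two adjacent
vertices `u` and `w`. -/
theorem sum_adjZ_avoiding [DecidableEq W] (H : SimpleGraph W) {u w : W} (huw : ¬ H.Adj u w)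
    (hne : u ≠ w) :
    ∑ x, ∑ y, (if x ≠ u ∧ x ≠ w ∧ y ≠ u ∧ y ≠ w then adjZ H x y else 0)
      = degSum H - 2 * degZ H u - 2 * degZ H w := by
  have h1 : adjZ H u u = 0 := adjZ_of_not_adj (H.irrefl)
  have h2 : adjZ H w w = 0 := adjZ_of_not_adj (H.irrefl)
  have h3 : adjZ H u w = 0 := adjZ_of_not_adj huw
  have h4 : adjZ H w u = 0 := adjZ_of_not_adj fun h => huw h.symm
  have h : ∀ x y, (if x ≠ u ∧ x ≠ w ∧ y ≠ u ∧ y ≠ w then adjZ H x y else 0) =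
      adjZ H x y - (if x = u then adjZ H u y else 0) - (if x = w then adjZ H w y else 0)
        - (if y = u then adjZ H x u else 0) - (if y = w then adjZ H x w else 0) := by
    intro x y
    by_cases hx : x = u
    · subst hx
      by_cases hy : y = x
      · subst hy; simp [h1, hne]
      · by_cases hy' : y = w
        · subst hy'; simp [h3, hne, hne.symm]
        · simp [hy, hy', hne]
    · by_cases hx' : x = w
      · subst hx'
        by_cases hy : y = u
        · subst hy; simp [h4, hne, hx]
        · by_cases hy' : y = x
          · subst hy'; simp [h2, hx]
          · simp [hy, hy', hx]
      · by_cases hy : y = u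
        · subst hy; simp [hx, hx', hne]
        · by_cases hy' : y = w
          · subst hy'; simp [hx, hx', hy]
          · simp [hx, hx', hy, hy']
  simp only [h, Finset.sum_sub_distrib]
  have e1 : ∑ x, ∑ y, (if x = u then adjZ H u y else 0) = degZ H u := by
    rw [Finset.sum_comm]; simp [degZ]
  have e2 : ∑ x, ∑ y, (if x = w then adjZ H w y else 0) = degZ H w := by
    rw [Finset.sum_comm]; simp [degZ]
  have e3 : ∑ x, ∑ y, (if y = u then adjZ H x u else 0) = degZ H u := by
    simp [sum_adjZ_right]
  have e4 : ∑ x, ∑ y, (if y = w then adjZ H x w else 0) = degZ H w := by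
    simp [sum_adjZ_right]
  rw [e1, e2, e3, e4]
  simp only [degSum, degZ]
  ring

theorem sum_adjZ_mul_degree (G : SimpleGraph W) (c : W → ℤ) :
    ∑ u, ∑ w, adjZ G u w * c w = ∑ w, degZ G w * c w := by
  rw [Finset.sum_comm]
  exact Finset.sum_congr rfl fun w _ => by rw [← Finset.sum_mul, sum_adjZ_right]

theorem graphH0_red_adj (u v : Fin 4) :
    graphH0.red.Adj u v ↔ u = 0 ∧ v = 2 ∨ u = 2 ∧ v = 0 := by
  simp only [graphH0, SimpleGraph.fromEdgeSet_adj, Set.mem_singleton_iff, Sym2.eq_iff]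
  revert u v; decide

theorem graphH0_blue_adj (u v : Fin 4) :
    graphH0.blue.Adj u v ↔ u = 1 ∧ v = 3 ∨ u = 3 ∧ v = 1 := by
  simp only [graphH0, SimpleGraph.fromEdgeSet_adj, Set.mem_singleton_iff, Sym2.eq_iff]
  revert u v; decide

/-- Embeddings of `graphH0` correspond to quadruples consisting of an edge and a disjoint non-edge. -/
def embeddingEquiv (G : SimpleGraph W) :
    {f : Fin 4 ↪ W // (∀ u v, graphH0.red.Adj u v → G.Adj (f u) (f v)) ∧
      (∀ u v, graphH0.blue.Adj u v → ¬ G.Adj (f u) (f v))} ≃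
    {p : (W × W) × W × W // G.Adj p.1.1 p.1.2 ∧ Gᶜ.Adj p.2.1 p.2.2 ∧
      p.2.1 ≠ p.1.1 ∧ p.2.1 ≠ p.1.2 ∧ p.2.2 ≠ p.1.1 ∧ p.2.2 ≠ p.1.2} where
  toFun f := ⟨((f.1 0, f.1 2), f.1 1, f.1 3),
    f.2.1 0 2 ((graphH0_red_adj _ _).2 (by decide)),
    ⟨f.1.injective.ne (by decide), f.2.2 1 3 ((graphH0_blue_adj _ _).2 (by decide))⟩,
    f.1.injective.ne (by decide), f.1.injective.ne (by decide),
    f.1.injective.ne (by decide), f.1.injective.ne (by decide)⟩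
  invFun p := ⟨⟨![p.1.1.1, p.1.2.1, p.1.1.2, p.1.2.2], by
      obtain ⟨⟨⟨a, b⟩, c, d⟩, h1, h2, h3, h4, h5, h6⟩ := p
      have h7 := h1.ne
      have h8 := h2.ne
      dsimp only at *
      intro i j hij
      fin_cases i <;> fin_cases j <;> simp_all⟩, by
      obtain ⟨⟨⟨a, b⟩, c, d⟩, h1, h2, h3, h4, h5, h6⟩ := p
      refine ⟨fun u v h => ?_, fun u v h => ?_⟩
      · rcases (graphH0_red_adj _ _).1 h with ⟨rfl, rfl⟩ | ⟨rfl, rfl⟩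
        · exact h1
        · exact h1.symm
      · rcases (graphH0_blue_adj _ _).1 h with ⟨rfl, rfl⟩ | ⟨rfl, rfl⟩
        · exact h2.2
        · exact fun h => h2.2 h.symm⟩
  left_inv f := by
    apply Subtype.ext
    ext i
    fin_cases i <;> rfl
  right_inv p := rfl

/-- For each ordered edge uw, the ordered non-edges avoiding u and w number `degSum Gᶜ` minus twice
the complement degrees of u and w. Summing over edges weights each vertex by its degree. -/
theorem embCount_graphH0 (G : SimpleGraph W) :
    (embCount graphH0 G : ℤ) =
      degFunctional (((Fintype.card W : ℤ) - 1) * (Fintype.card W - 4)) G := by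
  classical
  have hcount : (embCount graphH0 G : ℤ) = ∑ u, ∑ w, adjZ G u w *
      ∑ x, ∑ y, (if x ≠ u ∧ x ≠ w ∧ y ≠ u ∧ y ≠ w then adjZ Gᶜ x y else 0) := by
    rw [embCount, Nat.card_congr (embeddingEquiv G), Nat.card_eq_fintype_card, Fintype.card_subtype,
      Finset.card_filter]
    push_cast
    rw [Fintype.sum_prod_type, Fintype.sum_prod_type]
    refine Finset.sum_congr rfl fun u _ => Finset.sum_congr rfl fun w _ => ?_
    rw [Fintype.sum_prod_type, Finset.mul_sum]
    refine Finset.sum_congr rfl fun x _ => ?_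
    rw [Finset.mul_sum]
    refine Finset.sum_congr rfl fun y _ => ?_
    by_cases h1 : G.Adj u w
    · rw [adjZ_of_adj h1, one_mul]
      by_cases h2 : Gᶜ.Adj x y
      · rw [adjZ_of_adj h2]
        exact if_congr (by simp only [h1, h2, true_and]) rfl rfl
      · rw [adjZ_of_not_adj h2, ite_self]
        exact if_neg fun h => h2 h.2.1
    · rw [adjZ_of_not_adj h1, zero_mul]
      exact if_neg fun h => h1 h.1
  have hterm : ∀ u w, adjZ G u w *
      ∑ x, ∑ y, (if x ≠ u ∧ x ≠ w ∧ y ≠ u ∧ y ≠ w then adjZ Gᶜ x y else 0)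
      = adjZ G u w * degSum Gᶜ - 2 * (adjZ G w u * degZ Gᶜ u) - 2 * (adjZ G u w * degZ Gᶜ w) := by
    intro u w
    rw [adjZ_comm G w u]
    by_cases h1 : G.Adj u w
    · rw [sum_adjZ_avoiding Gᶜ (fun h => h.2 h1) h1.ne]
      ring
    · rw [adjZ_of_not_adj h1]; ring
  rw [hcount]
  simp only [hterm, Finset.sum_sub_distrib, ← Finset.mul_sum, sum_adjZ_mul_degree]
  rw [Finset.sum_comm (f := fun u w => adjZ G w u * degZ Gᶜ u), sum_adjZ_mul_degree]
  simp only [← Finset.sum_mul]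
  have hd : ∑ w, degZ G w * degZ Gᶜ w = (Fintype.card W - 1) * degSum G - degSqSum G := by
    simp only [degSum, degSqSum, Finset.mul_sum, ← Finset.sum_sub_distrib]
    exact Finset.sum_congr rfl fun w _ => by rw [degZ_compl]; ring
  rw [hd, degSum_compl, degFunctional]
  change degSum G * _ - _ - _ = _
  ring

end Embeddings

/-! ### Unimodality of the clique values and the square criterion -/

section CliqueValues

/-- The parameter for which the degree functional counts embeddings of `graphH0`. -/
def embParam (n : ℤ) : ℤ := (n - 1) * (n - 4)

theorem dualParam_embParam (n : ℤ) : dualParam (embParam n) n = embParam n := by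
  unfold dualParam embParam; ring

theorem completeValue_embParam_self (n : ℤ) : completeValue (embParam n) n = 0 := by
  unfold completeValue embParam; ring

/-- Twice the last factor equals 2n² - 10n + 13 - (2m - 3)². This is the source of k₀ and of the
square condition. -/
theorem completeValue_add_one (n m : ℤ) : completeValue (embParam n) (m + 1) =
    completeValue (embParam n) m + 2 * m * (n ^ 2 - 5 * n + 2 - (2 * m ^ 2 - 6 * m)) := by
  unfold completeValue embParam; ring

/-- The number `k` is the integer part of `(3 + √(2n² - 10n + 13)) / 2`. -/
structure IsOptimalIndex (n k : ℕ) : Prop where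
  two_le : 2 ≤ k
  add_one_lt : k + 1 < n
  le : 2 * (k : ℤ) ^ 2 - 6 * k ≤ (n : ℤ) ^ 2 - 5 * n + 2
  lt : (n : ℤ) ^ 2 - 5 * n + 2 < 2 * ((k : ℤ) + 1) ^ 2 - 6 * (k + 1)

theorem isOptimalIndex_floor {n : ℕ} (hn : 4 ≤ n) :
    IsOptimalIndex n ⌊(3 + Real.sqrt (2 * (n : ℝ) ^ 2 - 10 * (n : ℝ) + 13)) / 2⌋₊ := by
  have hnR : (4 : ℝ) ≤ n := by exact_mod_cast hn
  have hD : (1 : ℝ) ≤ 2 * (n : ℝ) ^ 2 - 10 * (n : ℝ) + 13 := by nlinarith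
  set s := Real.sqrt (2 * (n : ℝ) ^ 2 - 10 * (n : ℝ) + 13) with hs
  have hs1 : 1 ≤ s := Real.one_le_sqrt.2 hD
  have hsq : s ^ 2 = 2 * (n : ℝ) ^ 2 - 10 * (n : ℝ) + 13 := Real.sq_sqrt (by linarith)
  set k := ⌊(3 + s) / 2⌋₊ with hk
  have h2 : 2 ≤ k := Nat.le_floor (by push_cast; linarith)
  have hle : (k : ℝ) ≤ (3 + s) / 2 := Nat.floor_le (by linarith)
  have hlt : (3 + s) / 2 < k + 1 := Nat.lt_floor_add_one _
  have h2R : (2 : ℝ) ≤ k := by exact_mod_cast h2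
  have e1 : 2 * (k : ℤ) ^ 2 - 6 * k ≤ (n : ℤ) ^ 2 - 5 * n + 2 := by
    have : 2 * (k : ℝ) ^ 2 - 6 * k ≤ (n : ℝ) ^ 2 - 5 * n + 2 := by nlinarith
    exact_mod_cast this
  have e2 : (n : ℤ) ^ 2 - 5 * n + 2 < 2 * ((k : ℤ) + 1) ^ 2 - 6 * (k + 1) := by
    have : (n : ℝ) ^ 2 - 5 * n + 2 < 2 * ((k : ℝ) + 1) ^ 2 - 6 * (k + 1) := by nlinarith
    exact_mod_cast this
  refine ⟨h2, ?_, e1, e2⟩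
  by_contra hcon
  have h3 : (n : ℤ) ≤ k + 1 := by omega
  have h4 : (4 : ℤ) ≤ n := by omega
  nlinarith

variable {n k : ℕ}

theorem IsOptimalIndex.eq_iff_isSquare (h : IsOptimalIndex n k) :
    2 * (k : ℤ) ^ 2 - 6 * k = (n : ℤ) ^ 2 - 5 * n + 2 ↔
      IsSquare (2 * (n : ℤ) ^ 2 - 10 * (n : ℤ) + 13) := by
  obtain ⟨h2, -, hle, hlt⟩ := h
  have h2Z : (2 : ℤ) ≤ k := by omega
  constructor
  · intro heq
    exact ⟨2 * k - 3, by linarith⟩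
  · rintro ⟨r, hr⟩
    wlog hr0 : 0 ≤ r generalizing r
    · exact this (-r) (by rw [hr]; ring) (by omega)
    have h3 : 2 * (k : ℤ) - 3 ≤ r := by
      by_contra hcon
      nlinarith
    have h4 : r < 2 * (k : ℤ) - 1 := by
      by_contra hcon
      nlinarith
    -- The value 2k - 2 is impossible because 2n² - 10n + 13 is odd.
    rcases (show r = 2 * (k : ℤ) - 3 ∨ r = 2 * k - 2 by omega) with rfl | rfl
    · linarith
    · exfalso
      have : 2 * ((n : ℤ) ^ 2 - 5 * n + 6) + 1 = 2 * (2 * ((k : ℤ) - 1) ^ 2) := by linarith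
      omega

theorem IsOptimalIndex.completeValue_le_succ (h : IsOptimalIndex n k) {m : ℕ} (hm : m ≤ k) :
    completeValue (embParam n) m ≤ completeValue (embParam n) (m + 1) := by
  rw [completeValue_add_one]
  rcases Nat.eq_zero_or_pos m with rfl | hm0
  · simp
  · have h1 := h.le
    have h2 : (1 : ℤ) ≤ m := by omega
    have h3 : (m : ℤ) ≤ k := by omega
    have h4 := h.two_le
    have h5 : 0 ≤ (n : ℤ) ^ 2 - 5 * n + 2 - (2 * m ^ 2 - 6 * m) := by
      have : 0 ≤ ((k : ℤ) - m) * (k + m - 3) := by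
        rcases hm.lt_or_eq with hlt | rfl
        · exact mul_nonneg (by omega) (by omega)
        · simp
      nlinarith
    have := mul_nonneg (show (0 : ℤ) ≤ 2 * m by omega) h5
    linarith

theorem IsOptimalIndex.completeValue_succ_lt (h : IsOptimalIndex n k) {m : ℕ} (hm : k + 1 ≤ m) :
    completeValue (embParam n) (m + 1) < completeValue (embParam n) m := by
  rw [completeValue_add_one]
  have h1 := h.lt
  have h2 := h.two_le
  have h3 : 0 ≤ ((m : ℤ) - (k + 1)) * (m + k - 2) := mul_nonneg (by omega) (by omega)
  have h5 : 0 < (2 * (m : ℤ) ^ 2 - 6 * m) - ((n : ℤ) ^ 2 - 5 * n + 2) := by nlinarith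
  have := mul_pos (show (0 : ℤ) < 2 * m by omega) h5
  linarith

theorem IsOptimalIndex.completeValue_le_of_le (h : IsOptimalIndex n k) {m j : ℕ} (hmj : m ≤ j)
    (hj : j ≤ k + 1) : completeValue (embParam n) m ≤ completeValue (embParam n) j := by
  induction j, hmj using Nat.le_induction with
  | base => exact le_rfl
  | succ j _ ih =>
    have := h.completeValue_le_succ (m := j) (by omega)
    push_cast
    exact (ih (by omega)).trans this

theorem IsOptimalIndex.completeValue_lt_of_lt (h : IsOptimalIndex n k) {j : ℕ} (hj : k + 1 < j) :
    completeValue (embParam n) j < completeValue (embParam n) (k + 1) := by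
  induction j, hj using Nat.le_induction with
  | base => exact_mod_cast h.completeValue_succ_lt (m := k + 1) le_rfl
  | succ j hkj ih =>
    have := h.completeValue_succ_lt (m := j) (by omega)
    push_cast
    exact this.trans ih

theorem IsOptimalIndex.completeValue_le (h : IsOptimalIndex n k) (m : ℕ) :
    completeValue (embParam n) m ≤ completeValue (embParam n) (k + 1) := by
  rcases le_or_gt m (k + 1) with hm | hm
  · exact_mod_cast h.completeValue_le_of_le hm le_rfl
  · exact (h.completeValue_lt_of_lt hm).le

theorem isSquare_of_completeValue_eq {m : ℕ} (hm : 1 ≤ m)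
    (h : completeValue (embParam n) m = completeValue (embParam n) (m + 1)) :
    IsSquare (2 * (n : ℤ) ^ 2 - 10 * (n : ℤ) + 13) := by
  rw [completeValue_add_one] at h
  have h1 : 2 * (m : ℤ) * ((n : ℤ) ^ 2 - 5 * n + 2 - (2 * m ^ 2 - 6 * m)) = 0 := by linarith
  have h2 := (mul_eq_zero.1 h1).resolve_left (by omega)
  exact ⟨2 * m - 3, by linarith⟩

theorem IsOptimalIndex.eq_of_completeValue_eq (h : IsOptimalIndex n k)
    (hsq : ¬ IsSquare (2 * (n : ℤ) ^ 2 - 10 * (n : ℤ) + 13)) {m : ℕ}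
    (hm : completeValue (embParam n) m = completeValue (embParam n) (k + 1)) : m = k + 1 := by
  rcases lt_trichotomy m (k + 1) with hlt | heq | hgt
  · have h1 := h.completeValue_le_of_le (m := m) (j := k) (by omega) (by omega)
    have h2 := h.completeValue_le_succ (m := k) le_rfl
    have h3 := h.two_le
    exact absurd (isSquare_of_completeValue_eq (by omega) (le_antisymm h2 (by linarith))) hsq
  · exact heq
  · exact absurd hm (h.completeValue_lt_of_lt hgt).ne

end CliqueValues

/-! ### Extremal graphs: value, uniqueness, and the families in the square case -/

section Extremal

variable {n k : ℕ}

theorem isExtremal_iff_isOptimal (G : SimpleGraph (Fin n)) :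
    IsExtremal graphH0 G ↔ IsOptimal (embParam n) G := by
  have h : ∀ G : SimpleGraph (Fin n), degFunctional (embParam n) G = embCount graphH0 G :=
    fun G => by rw [embCount_graphH0, Fintype.card_fin, embParam]
  simp only [IsOptimal, h, Nat.cast_le]
  unfold IsExtremal maxEmbCount
  constructor
  · intro hG H
    rw [hG]
    exact Finset.le_sup (f := fun G => embCount graphH0 G) (Finset.mem_univ H)
  · intro hG
    exact le_antisymm (Finset.le_sup (f := fun G => embCount graphH0 G) (Finset.mem_univ G))
      (Finset.sup_le fun H _ => hG H)

theorem splitValue_embParam (b : ℤ) (n : ℤ) :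
    splitValue (embParam n) (n - b) b = completeValue (embParam n) b := by
  rw [splitValue_eq_of_card, completeValue_embParam_self, dualParam_embParam, zero_add]

theorem degFunctional_embParam_compl (G : SimpleGraph (Fin n)) :
    degFunctional (embParam n) Gᶜ = degFunctional (embParam n) G := by
  rw [degFunctional_compl, Fintype.card_fin, completeValue_embParam_self, dualParam_embParam,
    zero_add]

theorem IsOptimal.degFunctional_eq (h : IsOptimalIndex n k) {G : SimpleGraph (Fin n)}
    (hG : IsOptimal (embParam n) G) :
    degFunctional (embParam n) G = completeValue (embParam n) (k + 1) := by
  refine le_antisymm ?_ ?_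
  · rcases IsOptimal.structured _ _ _ rfl _ G hG with ⟨A, hA⟩ | ⟨A, hA⟩ |
      ⟨m, -, -, hm, -⟩ | ⟨m, -, -, hm, -⟩
    · rw [hA, degFunctional_cliqueOn]
      exact h.completeValue_le _
    · rw [← degFunctional_embParam_compl, hA, degFunctional_cliqueOn]
      exact h.completeValue_le _
    · rw [← hm]
      exact h.completeValue_le _
    · rw [← hm, Fintype.card_fin, splitValue_embParam]
      exact h.completeValue_le _
  · exact_mod_cast hG.completeValue_le (m := k + 1) (by
      rw [Fintype.card_fin]; exact h.add_one_lt.le)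

/-- Some maximiser exists by finiteness, and every maximiser has this value, so attaining the value
suffices. -/
theorem IsOptimalIndex.isExtremal_iff (h : IsOptimalIndex n k) (G : SimpleGraph (Fin n)) :
    IsExtremal graphH0 G ↔
      degFunctional (embParam n) G = completeValue (embParam n) (k + 1) := by
  rw [isExtremal_iff_isOptimal]
  refine ⟨fun hG => hG.degFunctional_eq h, fun hG => ?_⟩
  obtain ⟨H, hH⟩ := Finite.exists_max fun H : SimpleGraph (Fin n) => degFunctional (embParam n) H
  have hopt : IsOptimal (embParam n) H := hH
  have := hopt.degFunctional_eq h
  intro H'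
  rw [hG, ← this]
  exact hH H'

theorem eq_cliqueOn_of_not_isSquare (hsq : ¬ IsSquare (2 * (n : ℤ) ^ 2 - 10 * (n : ℤ) + 13))
    {G : SimpleGraph (Fin n)} (hG : IsOptimal (embParam n) G) :
    (∃ A, G = cliqueOn A) ∨ ∃ A, Gᶜ = cliqueOn A := by
  rcases IsOptimal.structured _ _ _ rfl _ G hG with hA | hA | ⟨m, h1, -, h3, h4⟩ |
    ⟨m, h1, -, h3, h4⟩
  · exact Or.inl hA
  · exact Or.inr hA
  · exact absurd (isSquare_of_completeValue_eq h1 (h3.trans h4.symm)) hsq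
  · rw [Fintype.card_fin, splitValue_embParam] at h3 h4
    exact absurd (isSquare_of_completeValue_eq h1 (h3.trans h4.symm)) hsq

theorem nonempty_iso_cliqueOn {V : Type*} [Finite V] {A B : Finset V} (h : A.card = B.card) :
    Nonempty (cliqueOn A ≃g cliqueOn B) := by
  classical
  let e : {x // x ∈ A} ≃ {x // x ∈ B} := Finset.equivOfCardEq h
  have hmem : ∀ x, e.extendSubtype x ∈ B ↔ x ∈ A := fun x =>
    ⟨fun hx => by_contra fun hxA => e.extendSubtype_not_mem x hxA hx, e.extendSubtype_mem x⟩
  exact ⟨⟨e.extendSubtype, by simp [cliqueOn_adj, hmem]⟩⟩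

theorem nonempty_iso_compl {V W : Type*} {G : SimpleGraph V} {H : SimpleGraph W}
    (h : Nonempty (G ≃g H)) : Nonempty (Gᶜ ≃g Hᶜ) := by
  obtain ⟨e⟩ := h
  exact ⟨⟨e.toEquiv, fun {a b} => by
    have : H.Adj (e a) (e b) ↔ G.Adj a b := e.map_adj_iff
    simp [SimpleGraph.compl_adj, this]⟩⟩

theorem cliqueIndex_choose (hk : 1 ≤ k) : cliqueIndex ((k + 1).choose 2) = k := by
  have h1 : (k + 1).choose 2 = k + k.choose 2 := by
    rw [Nat.choose_succ_succ' k 1, Nat.choose_one_right]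
  refine (cliqueIndex_isGreatest (by omega)).unique ⟨?_, fun m hm => ?_⟩
  · change k.choose 2 < (k + 1).choose 2
    omega
  · by_contra hlt
    have hm' : m.choose 2 < (k + 1).choose 2 := hm
    exact absurd (Nat.choose_le_choose 2 (show k + 1 ≤ m by omega)) (not_le.2 hm')

theorem quasiClique_choose (hk : 1 ≤ k) :
    quasiClique n ((k + 1).choose 2) =
      cliqueOn ((Finset.univ : Finset (Fin n)).filter fun i : Fin n => (i : ℕ) < k + 1) := by
  ext i j
  simp only [quasiClique, SimpleGraph.fromRel_adj, cliqueIndex_choose hk, cliqueOn_adj,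
    Finset.mem_filter, Finset.mem_univ, true_and, Nat.sub_self, Nat.not_lt_zero, and_false,
    not_false_eq_true, and_true, ne_eq, Fin.ext_iff]
  omega

theorem card_filter_val_lt {m : ℕ} (hm : m ≤ n) :
    ((Finset.univ : Finset (Fin n)).filter fun i : Fin n => (i : ℕ) < m).card = m := by
  rw [Fin.card_filter_val_lt, min_eq_right hm]

/-- The complete graph on the first `k` vertices together with vertex `k`, which is joined to the
first `t` vertices. -/
def cliqueWithTail (n k t : ℕ) (hk : k < n) : SimpleGraph (Fin n) :=
  cliqueWithVertex (Finset.univ.filter fun i => (i : ℕ) < k)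
    (Finset.univ.filter fun i => (i : ℕ) < t) ⟨k, hk⟩

theorem filter_val_lt_subset {t : ℕ} (ht : t ≤ k) :
    ((Finset.univ : Finset (Fin n)).filter fun i : Fin n => (i : ℕ) < t) ⊆
      Finset.univ.filter fun i : Fin n => (i : ℕ) < k := by
  intro i
  simp only [Finset.mem_filter, Finset.mem_univ, true_and]
  omega

theorem notMem_filter_val_lt (hk : k < n) :
    (⟨k, hk⟩ : Fin n) ∉ (Finset.univ : Finset (Fin n)).filter fun i : Fin n => (i : ℕ) < k := by
  simp

theorem degSum_cliqueWithTail {t : ℕ} (hk : k < n) (ht : t ≤ k) :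
    degSum (cliqueWithTail n k t hk) = k * ((k : ℤ) - 1) + 2 * t := by
  rw [cliqueWithTail, degSum_cliqueWithVertex (filter_val_lt_subset ht) (notMem_filter_val_lt hk),
    card_filter_val_lt hk.le, card_filter_val_lt (ht.trans hk.le)]

/-- In the square case K_k and K_{k+1} have the same value, so the affine interpolation between them
is constant in t. -/
theorem IsOptimalIndex.isExtremal_cliqueWithTail (h : IsOptimalIndex n k)
    (hsq : IsSquare (2 * (n : ℤ) ^ 2 - 10 * (n : ℤ) + 13)) (hk : k < n) {t : ℕ} (ht : t ≤ k) :
    IsExtremal graphH0 (cliqueWithTail n k t hk) := by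
  rw [h.isExtremal_iff]
  have h1 := degFunctional_cliqueWithVertex (embParam n) (filter_val_lt_subset (n := n) ht)
    (notMem_filter_val_lt hk)
  rw [card_filter_val_lt hk.le, card_filter_val_lt (ht.trans hk.le), completeValue_add_one,
    h.eq_iff_isSquare.2 hsq] at h1
  rw [completeValue_add_one, h.eq_iff_isSquare.2 hsq]
  have h2 : (k : ℤ) ≠ 0 := by
    have := h.two_le
    omega
  refine mul_left_cancel₀ h2 (h1.trans ?_)
  ring

theorem IsExtremal.compl (h : IsOptimalIndex n k) {G : SimpleGraph (Fin n)}
    (hG : IsExtremal graphH0 G) : IsExtremal graphH0 Gᶜ := by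
  rw [h.isExtremal_iff] at hG ⊢
  rw [degFunctional_embParam_compl, hG]

/-- Since k + 1 < n, the last vertex is isolated in the first graph and dominating in the second,
and no graph on at least two vertices has both kinds. -/
theorem IsOptimalIndex.isEmpty_iso_compl (h : IsOptimalIndex n k) (hk : k < n) {s t : ℕ}
    (hs : s ≤ k) (ht : t ≤ k) :
    IsEmpty (cliqueWithTail n k s hk ≃g (cliqueWithTail n k t hk)ᶜ) := by
  refine ⟨fun e => ?_⟩
  have hn := h.add_one_lt
  have h2 := h.two_le
  have hiso : ∀ r ≤ k, ∀ x, ¬ (cliqueWithTail n k r hk).Adj ⟨n - 1, by omega⟩ x := by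
    intro r hr x
    simp only [cliqueWithTail, cliqueWithVertex, Finset.mem_filter, Finset.mem_univ, true_and,
      Fin.ext_iff]
    omega
  have hdom : ∀ x, x ≠ (⟨n - 1, by omega⟩ : Fin n) →
      (cliqueWithTail n k t hk)ᶜ.Adj ⟨n - 1, by omega⟩ x := fun x hx => ⟨hx.symm, hiso t ht x⟩
  have hno : ∀ y, ¬ (cliqueWithTail n k t hk)ᶜ.Adj (e ⟨n - 1, by omega⟩) y := by
    intro y hy
    obtain ⟨x, rfl⟩ := e.surjective y
    exact hiso s hs x (e.map_adj_iff.1 hy)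
  by_cases hv : e ⟨n - 1, by omega⟩ = (⟨n - 1, by omega⟩ : Fin n)
  · rw [hv] at hno
    exact hno ⟨0, by omega⟩ (hdom _ (by rw [ne_eq, Fin.ext_iff]; change ¬ (0 = n - 1); omega))
  · exact hno _ (hdom _ hv).symm

theorem IsOptimalIndex.exists_pairwise_nonisomorphic (h : IsOptimalIndex n k)
    (hsq : IsSquare (2 * (n : ℤ) ^ 2 - 10 * (n : ℤ) + 13)) :
    ∃ F : Fin (2 * (k + 1)) → SimpleGraph (Fin n),
      (∀ i, IsExtremal graphH0 (F i)) ∧ Pairwise fun i j => IsEmpty (F i ≃g F j) := by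
  have hk : k < n := by
    have := h.add_one_lt
    omega
  have hinj : ∀ {s t : ℕ}, s ≤ k → t ≤ k →
      Nonempty (cliqueWithTail n k s hk ≃g cliqueWithTail n k t hk) → s = t := by
    rintro s t hs ht ⟨e⟩
    have := degSum_iso e
    rw [degSum_cliqueWithTail hk hs, degSum_cliqueWithTail hk ht] at this
    omega
  -- The tails t = 0, …, k give k + 1 graphs, told apart by their edge numbers; their complements
  -- give k + 1 more.
  refine ⟨fun i => if (i : ℕ) ≤ k then cliqueWithTail n k i hk
    else (cliqueWithTail n k (i - (k + 1)) hk)ᶜ, fun i => ?_, fun i j hij => ?_⟩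
  · dsimp only
    split_ifs with hi
    · exact h.isExtremal_cliqueWithTail hsq hk hi
    · exact (h.isExtremal_cliqueWithTail hsq hk (by omega)).compl h
  · have hij' : (i : ℕ) ≠ j := fun h => hij (Fin.ext h)
    dsimp only
    split_ifs with hi hj hj
    · exact ⟨fun e => hij' (hinj hi hj ⟨e⟩)⟩
    · exact h.isEmpty_iso_compl hk hi (by omega)
    · exact ⟨fun e => (h.isEmpty_iso_compl hk hj (by omega)).false e.symm⟩
    · refine ⟨fun e => ?_⟩
      have h1 := nonempty_iso_compl ⟨e⟩
      rw [compl_compl, compl_compl] at h1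
      have := hinj (by omega) (by omega) h1
      omega

end Extremal

theorem mainTheorem8 (n : ℕ) (hn : 4 ≤ n) (k₀ : ℕ)
    (hk₀ : k₀ = ⌊(3 + Real.sqrt (2 * (n : ℝ) ^ 2 - 10 * (n : ℝ) + 13)) / 2⌋₊) :
    -- the quasi-clique below is defined
    (k₀ + 1).choose 2 ≤ n.choose 2 ∧
    maxEmbCount graphH0 n = embCount graphH0 (quasiClique n ((k₀ + 1).choose 2)) ∧
    (¬ IsSquare (2 * (n : ℤ) ^ 2 - 10 * (n : ℤ) + 13) →
      ∀ G : SimpleGraph (Fin n), IsExtremal graphH0 G ↔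
        (Nonempty (G ≃g quasiClique n ((k₀ + 1).choose 2)) ∨
          Nonempty (G ≃g (quasiClique n ((k₀ + 1).choose 2))ᶜ))) ∧
    (IsSquare (2 * (n : ℤ) ^ 2 - 10 * (n : ℤ) + 13) →
      ∃ F : Fin (2 * (k₀ + 1)) → SimpleGraph (Fin n),
        (∀ i, IsExtremal graphH0 (F i)) ∧
        Pairwise fun i j => IsEmpty (F i ≃g F j)) := by
  have h : IsOptimalIndex n k₀ := hk₀ ▸ isOptimalIndex_floor hn
  have hlt := h.add_one_lt
  have hQ := quasiClique_choose (n := n) (show 1 ≤ k₀ from le_trans (by norm_num) h.two_le)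
  have hcard := card_filter_val_lt (n := n) (m := k₀ + 1) hlt.le
  have hQval : degFunctional (embParam n) (quasiClique n ((k₀ + 1).choose 2)) =
      completeValue (embParam n) (k₀ + 1) := by
    rw [hQ, degFunctional_cliqueOn, hcard]
    push_cast
    rfl
  have hiso : ¬ IsSquare (2 * (n : ℤ) ^ 2 - 10 * (n : ℤ) + 13) → ∀ A : Finset (Fin n),
      IsExtremal graphH0 (cliqueOn A) →
        Nonempty (cliqueOn A ≃g quasiClique n ((k₀ + 1).choose 2)) := by
    intro hsq A hA
    rw [h.isExtremal_iff, degFunctional_cliqueOn] at hA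
    rw [hQ]
    exact nonempty_iso_cliqueOn ((h.eq_of_completeValue_eq hsq hA).trans hcard.symm)
  refine ⟨Nat.choose_le_choose 2 hlt.le, ((h.isExtremal_iff _).2 hQval).symm, fun hsq G => ?_,
    h.exists_pairwise_nonisomorphic⟩
  constructor
  · intro hG
    rcases eq_cliqueOn_of_not_isSquare hsq ((isExtremal_iff_isOptimal G).1 hG) with
      ⟨A, rfl⟩ | ⟨A, hA⟩
    · exact Or.inl (hiso hsq A hG)
    · have h1 := hG.compl h
      rw [hA] at h1
      have h2 := nonempty_iso_compl (hiso hsq A h1)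
      rw [← hA, compl_compl] at h2
      exact Or.inr h2
  · rintro (⟨⟨e⟩⟩ | ⟨⟨e⟩⟩)
    · rw [h.isExtremal_iff, degFunctional_iso _ e, hQval]
    · rw [h.isExtremal_iff, degFunctional_iso _ e, degFunctional_embParam_compl, hQval]
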